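/- Let $\Gamma$ be a topological group acting continuously on a compact metric space $X$. For a topological space $Y$ on which $\Gamma$ acts by homeomorphisms, let $E(Y,\Gamma)$ be the enveloping (Ellis) semigroup, that is, the closure of $\{y\mapsto\gamma y:\gamma\in\Gamma\}$ in $Y^Y$ for the topology of pointwise convergence, with composition as multiplication. Let $M(X)$ be the space of Borel probability measures on $X$ with the weak$^*$ topology, on which $\Gamma$ acts by push-forward. The natural map $\Phi:E(M(X),\Gamma)\to E(X,\Gamma)$ is the restriction to Dirac measures: $p\,\delta_x=\delta_{\Phi(p)x}$ for all $x\in X$. It is a continuous homomorphism of semigroups which sends (the map induced by) $\gamma$ to $\gamma$. The system $(X,\Gamma)$ is called injective if $\Phi$ is an isomorphism, i.e. both an isomorphism of semigroups and a homeomorphism (hence an isomorphism of dynamical systems). Let $\mathcal E(X,\Gamma)=E(C(X)^*,\Gamma)$ be the enveloping operator semigroup, where $C(X)$ is the space of complex continuous functions, $C(X)^*$ carries the weak$^*$ topology and $(\gamma\ell)(f)=\ell(f\circ\gamma)$; restriction to Dirac functionals likewise defines a canonical map $\mathcal E(X,\Gamma)\to E(X,\Gamma)$. The question of Pym and Köhler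 is whether this canonical map (equivalently, the natural map $\Phi$) is an isomorphism for every system. The system $(X,\Gamma)$ is minimal if every orbit is dense; distal if, whenever the closure in $X\times X$ of $\{(\gamma x,\gamma y):\gamma\in\Gamma\}$ meets the diagonal, $x=y$; equicontinuous if the maps $x\mapsto\gamma x$, $\gamma\in\Gamma$, are uniformly equicontinuous. **Theorem.** Suppose that $(X,\Gamma)$ is minimal and distal. Then $(X,\Gamma)$ is injective if and only if it is equicontinuous. Consequently, if $(X,\Gamma)$ is not equicontinuous, it answers the question of Pym and Köhler in the negative: neither the natural map $E(M(X),\Gamma)\to E(X,\Gamma)$ nor the canonical map $\mathcal E(X,\Gamma)\to E(X,\Gamma)$ is an isomorphism. -/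

import Mathlib

open MeasureTheory Topology

namespace TopDyn

/-! ### Dynamical systems, distality, equicontinuity -/

/-- Two points are proximal if their orbit in `X × X` accumulates at the diagonal, i.e. if there is
a net `γᵢ` in `Γ` such that `γᵢ x` and `γᵢ y` converge to a common limit. -/
def Proximal (Γ : Type*) {X : Type*} [Group Γ] [TopologicalSpace X] [MulAction Γ X]
    (x y : X) : Prop :=
  ∃ z : X, (z, z) ∈ closure (Set.range fun γ : Γ => (γ • x, γ • y))

/-- The system `(X, Γ)` is distal if it has no proximal pair of distinct points. -/
def IsDistal (Γ X : Type*) [Group Γ] [TopologicalSpace X] [MulAction Γ X] : Prop :=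
  ∀ x y : X, Proximal Γ x y → x = y

/-- The system `(X, Γ)` is equicontinuous if the maps `x ↦ γ • x`, `γ ∈ Γ`, are uniformly
equicontinuous. -/
def IsEquicontinuous (Γ X : Type*) [Group Γ] [UniformSpace X] [MulAction Γ X] : Prop :=
  UniformEquicontinuous fun (γ : Γ) (x : X) => γ • x

/-! ### The enveloping (Ellis) semigroup -/

/-- Self-maps of a topological space carry the topology of pointwise convergence. -/
instance instTopologicalSpaceEnd (Y : Type*) [TopologicalSpace Y] :
    TopologicalSpace (Function.End Y) :=
  inferInstanceAs (TopologicalSpace (Y → Y))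

/-- The self-map of `Y` given by `γ`. -/
def translation {Γ : Type*} (Y : Type*) [Group Γ] [MulAction Γ Y] (γ : Γ) : Function.End Y :=
  fun y => γ • y

section

variable (Γ Y : Type*) [Group Γ] [TopologicalSpace Y] [MulAction Γ Y]

theorem mul_mem_closure_translation [ContinuousConstSMul Γ Y] {p q : Function.End Y}
    (hp : p ∈ closure (Set.range (translation (Γ := Γ) Y)))
    (hq : q ∈ closure (Set.range (translation (Γ := Γ) Y))) :
    p * q ∈ closure (Set.range (translation (Γ := Γ) Y)) := by
  have hL : ∀ γ : Γ, translation Y γ * q ∈ closure (Set.range (translation (Γ := Γ) Y)) := by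
    intro γ
    have hc : Continuous fun r : Function.End Y => translation Y γ * r :=
      continuous_pi fun y => (continuous_const_smul γ).comp (continuous_apply y)
    refine map_mem_closure hc hq ?_
    rintro _ ⟨δ, rfl⟩
    exact ⟨γ * δ, funext fun y => mul_smul γ δ y⟩
  have hc : Continuous fun r : Function.End Y => r * q :=
    continuous_pi fun y => continuous_apply (q y)
  have h := map_mem_closure (t := closure (Set.range (translation (Γ := Γ) Y))) hc hp
    (by rintro _ ⟨γ, rfl⟩; exact hL γ)
  rwa [closure_closure] at h

/-- The enveloping semigroup `E(Y, Γ)`: the closure of the set of translations in `Y → Y`, for the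
topology of pointwise convergence. The multiplication is composition of maps. -/
def envelopingSemigroup [ContinuousConstSMul Γ Y] : Submonoid (Function.End Y) where
  carrier := closure (Set.range (translation (Γ := Γ) Y))
  mul_mem' hp hq := mul_mem_closure_translation Γ Y hp hq
  one_mem' := subset_closure ⟨1, funext fun y => one_smul Γ y⟩

variable {Γ}

/-- The image of `γ` in the enveloping semigroup. -/
def envelopingSemigroup.of [ContinuousConstSMul Γ Y] (γ : Γ) : envelopingSemigroup Γ Y :=
  ⟨translation Y γ, subset_closure ⟨γ, rfl⟩⟩

end

section Restriction

variable {Γ X Y : Type*} [Group Γ] [TopologicalSpace X] [MulAction Γ X]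
  [TopologicalSpace Y] [MulAction Γ Y] [ContinuousConstSMul Γ Y]

theorem exists_restrict (i : X → Y) (hi : IsClosedEmbedding i)
    (hΓ : ∀ (γ : Γ) (x : X), i (γ • x) = γ • i x) (p : envelopingSemigroup Γ Y) (x : X) :
    ∃ x' : X, i x' = p.1 (i x) := by
  have h : p.1 (i x) ∈ closure (Set.range i) :=
    map_mem_closure (f := fun r : Function.End Y => r (i x)) (continuous_apply (i x)) p.2
      (by rintro _ ⟨γ, rfl⟩; exact ⟨γ • x, hΓ γ x⟩)
  rwa [hi.isClosed_range.closure_eq] at h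

/-- The restriction of `p ∈ E(Y, Γ)` to a closed subsystem `i : X → Y`: the self-map `r` of `X` with
`i (r x) = p (i x)`. -/
noncomputable def restrictFun (i : X → Y) (hi : IsClosedEmbedding i)
    (hΓ : ∀ (γ : Γ) (x : X), i (γ • x) = γ • i x) (p : envelopingSemigroup Γ Y) :
    Function.End X :=
  fun x => (exists_restrict i hi hΓ p x).choose

variable (i : X → Y) (hi : IsClosedEmbedding i) (hΓ : ∀ (γ : Γ) (x : X), i (γ • x) = γ • i x)

theorem restrictFun_spec (p : envelopingSemigroup Γ Y) (x : X) :
    i (restrictFun i hi hΓ p x) = p.1 (i x) :=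
  (exists_restrict i hi hΓ p x).choose_spec

theorem continuous_restrictFun : Continuous (restrictFun i hi hΓ) := by
  refine continuous_pi fun x => hi.isInducing.continuous_iff.2 ?_
  have h : (i ∘ fun p => restrictFun i hi hΓ p x) = fun p => p.1 (i x) :=
    funext fun p => restrictFun_spec i hi hΓ p x
  rw [h]
  exact (continuous_apply (i x)).comp continuous_subtype_val

theorem restrictFun_of (γ : Γ) :
    restrictFun i hi hΓ (envelopingSemigroup.of Y γ) = translation X γ :=
  funext fun x => hi.injective <| (restrictFun_spec i hi hΓ _ x).trans (hΓ γ x).symm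

variable [ContinuousConstSMul Γ X]

theorem restrictFun_mem (p : envelopingSemigroup Γ Y) :
    restrictFun i hi hΓ p ∈ envelopingSemigroup Γ X := by
  have hp : p ∈ closure (Set.range (envelopingSemigroup.of (Γ := Γ) Y)) := by
    rw [closure_subtype, ← Set.range_comp]
    exact p.2
  refine map_mem_closure (continuous_restrictFun i hi hΓ) hp ?_
  rintro _ ⟨γ, rfl⟩
  exact ⟨γ, (restrictFun_of i hi hΓ γ).symm⟩

/-- Restriction to a closed subsystem `i : X → Y`, as a continuous homomorphism of semigroups
`E(Y, Γ) → E(X, Γ)`. -/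
noncomputable def restrict : envelopingSemigroup Γ Y →ₜ* envelopingSemigroup Γ X where
  toFun p := ⟨restrictFun i hi hΓ p, restrictFun_mem i hi hΓ p⟩
  map_one' := Subtype.ext <| funext fun x => hi.injective (restrictFun_spec i hi hΓ 1 x)
  map_mul' p q := Subtype.ext <| funext fun x => hi.injective <| by
    have h1 := restrictFun_spec i hi hΓ (p * q) x
    have h2 := restrictFun_spec i hi hΓ p (restrictFun i hi hΓ q x)
    rw [restrictFun_spec i hi hΓ q x] at h2
    exact h1.trans h2.symm
  continuous_toFun := (continuous_restrictFun i hi hΓ).subtype_mk _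

theorem restrict_spec (p : envelopingSemigroup Γ Y) (x : X) :
    i ((restrict i hi hΓ p).1 x) = p.1 (i x) :=
  restrictFun_spec i hi hΓ p x

/-- Restriction maps `γ` to `γ`; being multiplicative, it is a morphism of dynamical systems for the
actions of `Γ` by multiplication on the left. -/
theorem restrict_of (γ : Γ) :
    restrict i hi hΓ (envelopingSemigroup.of Y γ) = envelopingSemigroup.of X γ :=
  Subtype.ext (restrictFun_of i hi hΓ γ)

end Restriction

/-- A continuous homomorphism of topological semigroups is an isomorphism if it is the underlying
map of a multiplicative homeomorphism. -/
def IsIsomorphism {E F : Type*} [Monoid E] [TopologicalSpace E] [Monoid F] [TopologicalSpace F]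
    (Φ : E →ₜ* F) : Prop :=
  ∃ e : E ≃ₜ* F, ∀ p : E, e p = Φ p

/-! ### The system `(M(X), Γ)` of Borel probability measures -/

section Measures

variable {Γ X : Type*} [Group Γ] [MetricSpace X] [MeasurableSpace X] [BorelSpace X]
  [MulAction Γ X] [ContinuousConstSMul Γ X]

theorem aemeasurable_smul (γ : Γ) (μ : Measure X) : AEMeasurable (fun x : X => γ • x) μ :=
  (continuous_const_smul γ).measurable.aemeasurable

/-- `Γ` acts on probability measures by push-forward. The topology on `ProbabilityMeasure X` is the
topology of weak convergence (tested on bounded continuous functions). -/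
noncomputable instance instMulActionProbabilityMeasure : MulAction Γ (ProbabilityMeasure X) where
  smul γ μ := μ.map (aemeasurable_smul γ (μ : Measure X))
  one_smul μ := Subtype.ext <| by
    change Measure.map (fun x : X => (1 : Γ) • x) (μ : Measure X) = μ
    simp
  mul_smul γ δ μ := Subtype.ext <| by
    change Measure.map (fun x : X => (γ * δ) • x) (μ : Measure X)
      = Measure.map (fun x : X => γ • x) (Measure.map (fun x : X => δ • x) (μ : Measure X))
    rw [Measure.map_map (continuous_const_smul γ).measurable (continuous_const_smul δ).measurable]
    congr 1
    exact funext fun x => mul_smul γ δ x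

theorem smul_probabilityMeasure_def (γ : Γ) (μ : ProbabilityMeasure X) :
    γ • μ = μ.map (aemeasurable_smul γ (μ : Measure X)) :=
  rfl

instance instContinuousConstSMulProbabilityMeasure :
    ContinuousConstSMul Γ (ProbabilityMeasure X) where
  continuous_const_smul γ := ProbabilityMeasure.continuous_map (continuous_const_smul γ)

theorem isClosedEmbedding_dirac [CompactSpace X] :
    IsClosedEmbedding (fun x : X => diracProba x) :=
  continuous_diracProba.isClosedEmbedding injective_diracProba

theorem dirac_smul (γ : Γ) (x : X) : diracProba (γ • x) = γ • diracProba x :=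
  Subtype.ext (Measure.map_dirac' (continuous_const_smul γ).measurable x).symm

variable (Γ X)

/-- The natural map `E(M(X), Γ) → E(X, Γ)`, restricting `p` to the Dirac measures: the image `r` of
`p` is characterized by `p δ_x = δ_{r x}`. -/
noncomputable def naturalMap [CompactSpace X] :
    envelopingSemigroup Γ (ProbabilityMeasure X) →ₜ* envelopingSemigroup Γ X :=
  restrict (fun x : X => diracProba x) isClosedEmbedding_dirac dirac_smul

/-- The system `(X, Γ)` is injective if the natural map `E(M(X), Γ) → E(X, Γ)` is an
isomorphism. -/
def IsInjectiveSystem [CompactSpace X] : Prop :=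
  IsIsomorphism (naturalMap Γ X)

end Measures

/-! ### The enveloping operator semigroup -/

/-- The dual space `C(X)*` with its weak-* topology. -/
def FunctionDual (X : Type*) [TopologicalSpace X] [CompactSpace X] : Type _ :=
  WeakDual ℂ C(X, ℂ)

section Operators

variable {Γ X : Type*} [Group Γ] [MetricSpace X] [CompactSpace X]
  [MulAction Γ X] [ContinuousConstSMul Γ X]

instance : TopologicalSpace (FunctionDual X) := inferInstanceAs (TopologicalSpace (WeakDual ℂ _))

instance : T2Space (FunctionDual X) := inferInstanceAs (T2Space (WeakDual ℂ _))

/-- The value of a functional at a function. -/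
noncomputable def FunctionDual.eval (ℓ : FunctionDual X) (f : C(X, ℂ)) : ℂ :=
  (show WeakDual ℂ C(X, ℂ) from ℓ) f

theorem FunctionDual.ext {ℓ m : FunctionDual X} (h : ∀ f, ℓ.eval f = m.eval f) : ℓ = m :=
  DFunLike.ext (F := WeakDual ℂ C(X, ℂ)) ℓ m h

theorem FunctionDual.continuous_eval (f : C(X, ℂ)) :
    Continuous fun ℓ : FunctionDual X => ℓ.eval f :=
  WeakDual.eval_continuous f

theorem FunctionDual.continuous_of_eval {α : Type*} [TopologicalSpace α] {g : α → FunctionDual X}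
    (h : ∀ f, Continuous fun a => (g a).eval f) : Continuous g :=
  WeakDual.continuous_of_continuous_eval h

/-- The Koopman operator `f ↦ f ∘ γ` on `C(X)`. -/
noncomputable def koopman (γ : Γ) : C(X, ℂ) →L[ℂ] C(X, ℂ) :=
  ContinuousMap.compCLM ℂ ℂ ⟨fun x => γ • x, continuous_const_smul γ⟩

theorem koopman_apply (γ : Γ) (f : C(X, ℂ)) (x : X) : koopman γ f x = f (γ • x) :=
  rfl

/-- `Γ` acts on `C(X)*` by the operators dual to the Koopman operators: `(γ ℓ)(f) = ℓ (f ∘ γ)`. -/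
noncomputable instance instMulActionFunctionDual : MulAction Γ (FunctionDual X) where
  smul γ ℓ := (show C(X, ℂ) →L[ℂ] ℂ from ℓ).comp (koopman γ)
  one_smul ℓ := FunctionDual.ext fun f => by
    change (show C(X, ℂ) →L[ℂ] ℂ from ℓ) (koopman (1 : Γ) f) = (show C(X, ℂ) →L[ℂ] ℂ from ℓ) f
    congr 1
    ext x
    rw [koopman_apply, one_smul]
  mul_smul γ δ ℓ := FunctionDual.ext fun f => by
    change (show C(X, ℂ) →L[ℂ] ℂ from ℓ) (koopman (γ * δ) f)
      = (show C(X, ℂ) →L[ℂ] ℂ from ℓ) (koopman δ (koopman γ f))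
    congr 1
    ext x
    rw [koopman_apply, koopman_apply, koopman_apply, mul_smul]

theorem FunctionDual.smul_eval (γ : Γ) (ℓ : FunctionDual X) (f : C(X, ℂ)) :
    (γ • ℓ).eval f = ℓ.eval (koopman γ f) :=
  rfl

instance : ContinuousConstSMul Γ (FunctionDual X) where
  continuous_const_smul γ :=
    FunctionDual.continuous_of_eval fun f => FunctionDual.continuous_eval (koopman γ f)

/-- The Dirac functional `f ↦ f x`. -/
noncomputable def diracFunctional (x : X) : FunctionDual X :=
  (ContinuousMap.evalCLM ℂ x : C(X, ℂ) →L[ℂ] ℂ)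

theorem diracFunctional_eval (x : X) (f : C(X, ℂ)) : (diracFunctional x).eval f = f x :=
  rfl

theorem isClosedEmbedding_diracFunctional :
    IsClosedEmbedding (diracFunctional : X → FunctionDual X) := by
  refine Continuous.isClosedEmbedding (FunctionDual.continuous_of_eval fun f => f.continuous) ?_
  intro x y h
  have h1 : (diracFunctional x).eval (⟨fun z => (dist z y : ℂ), by fun_prop⟩ : C(X, ℂ))
      = (diracFunctional y).eval ⟨fun z => (dist z y : ℂ), by fun_prop⟩ := by rw [h]
  simpa [diracFunctional_eval] using h1

theorem diracFunctional_smul (γ : Γ) (x : X) :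
    diracFunctional (γ • x) = γ • diracFunctional x :=
  rfl

variable (Γ X)

/-- The enveloping operator semigroup of `(X, Γ)`: the closure of the set of operators on `C(X)*`
induced by the elements of `Γ`, for the topology of pointwise weak-* convergence. (The induced
operators are linear and have norm at most one, and so does every pointwise weak-* limit of them;
hence the closure may be taken among all self-maps of `C(X)*`.) -/
noncomputable def envelopingOperatorSemigroup : Submonoid (Function.End (FunctionDual X)) :=
  envelopingSemigroup Γ (FunctionDual X)

/-- The canonical map from the enveloping operator semigroup to `E(X, Γ)`, restricting an operator
`S` to the Dirac functionals: the image `r` of `S` is characterized by `S δ_x = δ_{r x}`. -/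
noncomputable def operatorNaturalMap :
    envelopingOperatorSemigroup Γ X →ₜ* envelopingSemigroup Γ X :=
  restrict (diracFunctional : X → FunctionDual X) isClosedEmbedding_diracFunctional
    diracFunctional_smul

end Operators

end TopDyn

/-!
Let `E(X)` and `E(M(X))` be the enveloping semigroups of `X` and of its space of probability
measures. An equicontinuous system is injective because translations that are close on a finite net
are uniformly close (`IsEquicontinuous.injective_naturalMap`). The substance is the converse: a
minimal, distal and injective system is equicontinuous.

As `X` is distal, `E(X)` is a group (`IsDistal.exists_mul_eq_one`), and injectivity makes `E(M(X))`
a group as well. Its elements are affine maps. Let `q` be one of them, with inverse `p`, and let `m`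
be a measure. Write `q m` as a combination of measures `ν z`, each concentrated near a point `z`.
Then `m` is the corresponding combination of the measures `p (ν z)`, and a translation close to `q`
brings almost all the mass of `p (ν z)` near `z`. Two translations close to `q` are therefore close
to each other for the distance `∫ d(γ x, γ' x) dm(x)`. By compactness of `E(M(X))`, the group `Γ` is
totally bounded for this distance, whatever the measure `m` (`exists_card_bound`).

On the other hand, suppose that `X` is not equicontinuous. If every element of `E(X)` were
determined by its values on some countable set, then the Baire category theorem would provide an
open set on which `Γ` is uniformly approximated by finitely many of its elements, and minimality
would give equicontinuity (`isEquicontinuous_of_determined`). So there is an `ε` such that, for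
every finite set, some element of `E(X)` fixes this set pointwise and moves another point by `ε`,
even after applying any element of `Γ` (`exists_fixatorsMove`). By minimality the moved point can be
found in any given open set, and products of such elements treat finitely many open sets at once:
some `γ` separates two points in each of them (`FixatorsMove.exists_smul_separating`). Splitting the
atoms of a finitely supported measure accordingly, one finds that the measures for which `Γ` has
`N` elements at mutual distance more than `ε / 32` form a dense open set
(`FixatorsMove.dense_separatedMeasures`). By Baire, some measure has this property for all `N`, which
contradicts total boundedness.

Finally, the canonical map from the enveloping operator semigroup factors through `E(M(X))`; if it is
an isomorphism then the first factor is onto and the system is injective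
(`isInjectiveSystem_of_isIsomorphism_operatorNaturalMap`).
-/

namespace TopDyn

open Filter

/-! ### The enveloping semigroup of a compact system -/

section Semigroup

instance instT2SpaceEnd (Y : Type*) [TopologicalSpace Y] [T2Space Y] :
    T2Space (Function.End Y) :=
  inferInstanceAs (T2Space (Y → Y))

instance instCompactSpaceEnd (Y : Type*) [TopologicalSpace Y] [CompactSpace Y] :
    CompactSpace (Function.End Y) :=
  inferInstanceAs (CompactSpace (Y → Y))

variable {Γ Y : Type*} [Group Γ] [TopologicalSpace Y] [MulAction Γ Y] [ContinuousConstSMul Γ Y]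

instance instCompactSpaceEnvelopingSemigroup [CompactSpace Y] :
    CompactSpace (envelopingSemigroup Γ Y) :=
  isCompact_iff_compactSpace.1
    (isClosed_closure (s := Set.range (translation (Γ := Γ) Y))).isCompact

theorem continuous_envelopingSemigroup_apply (y : Y) :
    Continuous fun p : envelopingSemigroup Γ Y => p.1 y :=
  (continuous_apply y).comp continuous_subtype_val

theorem continuous_mul_right_envelopingSemigroup (r : envelopingSemigroup Γ Y) :
    Continuous fun p : envelopingSemigroup Γ Y => p * r :=
  Continuous.subtype_mk
    (continuous_pi fun y => continuous_envelopingSemigroup_apply (r.1 y)) _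

theorem denseRange_of : DenseRange (envelopingSemigroup.of (Γ := Γ) Y) := by
  intro p
  rw [closure_subtype, ← Set.range_comp]
  exact p.2

/-- Every element of the enveloping semigroup is a pointwise limit of translations along a
filter on the acting group. -/
theorem exists_filter_tendsto (p : envelopingSemigroup Γ Y) :
    ∃ F : Filter Γ, F.NeBot ∧ ∀ y, Tendsto (fun γ : Γ => γ • y) F (𝓝 (p.1 y)) := by
  obtain ⟨u, hu, hup⟩ := mem_closure_iff_ultrafilter.1 p.2
  refine ⟨comap (translation (Γ := Γ) Y) u, NeBot.comap_of_range_mem u.neBot hu, fun y => ?_⟩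
  exact ((continuous_apply y).tendsto (p.1 : Y → Y)).comp (tendsto_comap.mono_right hup)

/-- In a distal system the identity is the only idempotent of a closed left ideal of the
enveloping semigroup, because an idempotent `u` makes `x` and `u x` proximal. Hence the enveloping
semigroup is a group. -/
theorem IsDistal.exists_mul_eq_one [CompactSpace Y] [T2Space Y] (h : IsDistal Γ Y)
    (p : envelopingSemigroup Γ Y) : ∃ q, q * p = 1 ∧ p * q = 1 := by
  have key : ∀ p : envelopingSemigroup Γ Y, ∃ q, q * p = 1 := by
    intro p
    obtain ⟨u, ⟨q, hq⟩, hu⟩ := exists_idempotent_in_compact_subsemigroup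
      continuous_mul_right_envelopingSemigroup (Set.range fun q => q * p) ⟨_, 1, rfl⟩
      (isCompact_range (continuous_mul_right_envelopingSemigroup p))
      (by
        rintro _ ⟨a, rfl⟩ _ ⟨b, rfl⟩
        exact ⟨a * p * b, by simp only [mul_assoc]⟩)
    refine ⟨q, hq.trans (Subtype.ext (funext fun y => ?_))⟩
    refine h _ _ ⟨u.1 y, ?_⟩
    have huy : u.1 (u.1 y) = u.1 y := congrFun (congrArg Subtype.val hu) y
    obtain ⟨F, hF, hlim⟩ := exists_filter_tendsto u
    have h2 := (hlim (u.1 y)).prodMk_nhds (hlim y)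
    rw [huy] at h2
    exact mem_closure_of_tendsto h2 (Eventually.of_forall fun γ => ⟨γ, rfl⟩)
  obtain ⟨q, hq⟩ := key p
  obtain ⟨r, hr⟩ := key q
  have hrp : r = p := by rw [← mul_one r, ← hq, ← mul_assoc, hr, one_mul]
  exact ⟨q, hq, hrp ▸ hr⟩

end Semigroup

section Metric

variable {Γ X : Type*} [Group Γ] [MetricSpace X] [MulAction Γ X]

/-- Two points whose orbits come arbitrarily close to each other are proximal. -/
theorem proximal_of_forall_exists_dist_lt [CompactSpace X] {x y : X}
    (h : ∀ ε > 0, ∃ γ : Γ, dist (γ • x) (γ • y) < ε) : Proximal Γ x y := by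
  choose γ hγ using fun n : ℕ => h (1 / (n + 1)) Nat.one_div_pos_of_nat
  obtain ⟨z, -, φ, hφ, hz⟩ := isCompact_univ.tendsto_subseq (x := fun n => γ n • x) fun _ =>
    Set.mem_univ _
  have hd : Tendsto (fun n => dist (γ (φ n) • x) (γ (φ n) • y)) atTop (𝓝 0) :=
    squeeze_zero (fun _ => dist_nonneg) (fun n => (hγ (φ n)).le)
      (tendsto_one_div_add_atTop_nhds_zero_nat.comp hφ.tendsto_atTop)
  have hz' := (tendsto_iff_of_dist hd).1 hz
  exact ⟨z, mem_closure_of_tendsto (hz.prodMk_nhds hz')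
    (Eventually.of_forall fun n => ⟨γ (φ n), rfl⟩)⟩

variable [ContinuousConstSMul Γ X]

theorem exists_forall_dist_smul_lt (p : envelopingSemigroup Γ X) {s : Set X} (hs : s.Finite)
    {ε : ℝ} (hε : 0 < ε) : ∃ γ : Γ, ∀ x ∈ s, dist (γ • x) (p.1 x) < ε := by
  obtain ⟨F, hF, hlim⟩ := exists_filter_tendsto p
  exact ((eventually_all_finite hs).2 fun x _ => Metric.tendsto_nhds.1 (hlim x) ε hε).exists

/-! ### Equicontinuity from countable determination -/

/-- In a minimal system, equicontinuity follows from the existence, for every `ε`, of one nonempty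
open set all of whose translates have diameter at most `ε`: finitely many translates of that set
cover the space. -/
theorem isEquicontinuous_of_exists_open [CompactSpace X] [MulAction.IsMinimal Γ X]
    (h : ∀ ε > 0, ∃ V : Set X, IsOpen V ∧ V.Nonempty ∧
      ∀ γ : Γ, ∀ x ∈ V, ∀ y ∈ V, dist (γ • x) (γ • y) ≤ ε) :
    IsEquicontinuous Γ X := by
  refine Metric.uniformEquicontinuous_iff.2 fun ε hε => ?_
  obtain ⟨V, hV, hne, hosc⟩ := h (ε / 2) (half_pos hε)
  obtain ⟨δ, hδ, hcov⟩ := lebesgue_number_lemma_of_metric (s := (Set.univ : Set X))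
    (c := fun γ : Γ => (fun x : X => γ • x) ⁻¹' V) isCompact_univ
    (fun γ => hV.preimage (continuous_const_smul γ))
    (fun x _ => Set.mem_iUnion.2 (hV.exists_smul_mem Γ x hne))
  refine ⟨δ, hδ, fun x y hxy γ => ?_⟩
  obtain ⟨η, hη⟩ := hcov x (Set.mem_univ x)
  have := hosc (γ * η⁻¹) _ (hη (Metric.mem_ball_self hδ)) _
    (hη (show y ∈ Metric.ball x δ by rwa [Metric.mem_ball, dist_comm]))
  simp only [smul_smul, inv_mul_cancel_right] at this
  linarith

/-- If two elements of the enveloping semigroup are equal as soon as they agree on a fixed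
countable set, here the union of the finite sets `C n`, then a minimal system is equicontinuous.
The points at which closeness of `γ` and `γ'` on `C n` up to `1 / (n + 1)` forces closeness up to
`ε` form closed sets `A n` covering `X`; the Baire category theorem gives an open set contained in
one of them, where all of `Γ` is uniformly approximated by finitely many elements. -/
theorem isEquicontinuous_of_determined [CompactSpace X] [MulAction.IsMinimal Γ X]
    (C : ℕ → Set X) (hC : ∀ n, (C n).Finite) (hmono : Monotone C)
    (hdet : ∀ p q : envelopingSemigroup Γ X, (∀ n, ∀ c ∈ C n, p.1 c = q.1 c) → p = q) :
    IsEquicontinuous Γ X := by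
  rcases isEmpty_or_nonempty X with hX | hX
  · exact Metric.uniformEquicontinuous_iff.2 fun ε hε => ⟨1, one_pos, fun x => (hX.false x).elim⟩
  refine isEquicontinuous_of_exists_open fun ε' hε' => ?_
  obtain ⟨ε, hε, hεε⟩ : ∃ ε : ℝ, 0 < ε ∧ 3 * ε ≤ ε' := ⟨ε' / 3, by positivity, by linarith⟩
  let A : ℕ → Set X := fun n => {x | ∀ γ γ' : Γ,
    (∀ c ∈ C n, dist (γ • c) (γ' • c) < 1 / ((n : ℝ) + 1)) → dist (γ • x) (γ' • x) ≤ ε}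
  have hAc : ∀ n, IsClosed (A n) := by
    intro n
    simp only [A, Set.ofPred_forall]
    refine isClosed_iInter fun γ => isClosed_iInter fun γ' => isClosed_iInter fun _ => ?_
    exact isClosed_le ((continuous_const_smul γ).dist (continuous_const_smul γ')) continuous_const
  have hAu : ⋃ n, A n = Set.univ := by
    refine Set.eq_univ_of_forall fun x => ?_
    by_contra hx
    simp only [A, Set.mem_iUnion, Set.mem_ofPred_eq, not_exists, not_forall, not_le] at hx
    choose γ γ' hγ hlt using hx
    obtain ⟨⟨p, q⟩, hpq⟩ := exists_clusterPt_of_compactSpace (map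
      (fun n => (envelopingSemigroup.of X (γ n), envelopingSemigroup.of X (γ' n))) atTop)
    obtain ⟨U, hU, hlim⟩ := mapClusterPt_iff_ultrafilter.1 hpq
    have h1 : ∀ y, Tendsto (fun n => dist (γ n • y) (γ' n • y)) U (𝓝 (dist (p.1 y) (q.1 y))) :=
      fun y => (((continuous_envelopingSemigroup_apply y).tendsto p).comp
        ((continuous_fst.tendsto (p, q)).comp hlim)).dist
        (((continuous_envelopingSemigroup_apply y).tendsto q).comp
        ((continuous_snd.tendsto (p, q)).comp hlim))
    have hpq' : p = q := hdet p q fun n c hc => by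
      refine dist_le_zero.1 (le_of_tendsto_of_tendsto (h1 c)
        (tendsto_one_div_add_atTop_nhds_zero_nat.mono_left hU) ?_)
      filter_upwards [hU (eventually_ge_atTop n)] with k hk
      exact (hγ k c (hmono hk hc)).le
    have := ge_of_tendsto (h1 x) (Eventually.of_forall fun n => (hlt n).le)
    rw [hpq', dist_self] at this
    exact absurd this (not_le.2 hε)
  obtain ⟨n, x₀, hx₀⟩ := nonempty_interior_of_iUnion_of_closed hAc hAu
  have : Fintype (C n) := (hC n).fintype
  obtain ⟨t, htr, htf, ht⟩ := Metric.finite_approx_of_totallyBounded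
    (isCompact_univ.totallyBounded.subset (Set.subset_univ
      (Set.range fun (γ : Γ) (c : C n) => γ • (c : X)))) (1 / ((n : ℝ) + 1)) Nat.one_div_pos_of_nat
  have htr' : ∀ z ∈ t, ∃ γ : Γ, (fun c : C n => γ • (c : X)) = z := fun z hz => htr hz
  choose! g hg using htr'
  have hcont : ∀ᶠ x in 𝓝 x₀, ∀ y ∈ t, dist (g y • x) (g y • x₀) < ε / 2 :=
    (eventually_all_finite htf).2 fun y _ =>
      Metric.tendsto_nhds.1 ((continuous_const_smul (g y)).tendsto x₀) _ (half_pos hε)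
  obtain ⟨W, hW, hWo, hxW⟩ := eventually_nhds_iff.1 hcont
  refine ⟨interior (A n) ∩ W, isOpen_interior.inter hWo, ⟨x₀, hx₀, hxW⟩, ?_⟩
  intro γ x hx y hy
  obtain ⟨z, hz, hzγ⟩ := Set.mem_iUnion₂.1 (ht ⟨γ, rfl⟩)
  have hclose : ∀ c ∈ C n, dist (γ • c) (g z • c) < 1 / ((n : ℝ) + 1) := by
    intro c hc
    have := dist_le_pi_dist (fun c : C n => γ • (c : X)) (fun c : C n => g z • (c : X)) ⟨c, hc⟩
    rw [hg z hz] at this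
    exact this.trans_lt (Metric.mem_ball.1 hzγ)
  have hx1 := interior_subset hx.1 γ (g z) hclose
  have hy1 := interior_subset hy.1 γ (g z) hclose
  have hx2 := hW x hx.2 z hz
  have hy2 := hW y hy.2 z hz
  have := dist_triangle4 (γ • x) (g z • x) (g z • y) (γ • y)
  have := dist_triangle_right (g z • x) (g z • y) (g z • x₀)
  rw [dist_comm (γ • y)] at hy1
  linarith

/-- For every finite set `C`, the pointwise fixator of `C` in the enveloping semigroup contains an
element `p` that moves some point `x` in such a way that `δ (p x)` and `δ x` are at distance at
least `ε` for all `δ ∈ Γ`. -/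
def FixatorsMove (Γ X : Type*) [Group Γ] [MetricSpace X] [MulAction Γ X]
    [ContinuousConstSMul Γ X] (ε : ℝ) : Prop :=
  ∀ C : Set X, C.Finite → ∃ p : envelopingSemigroup Γ X, (∀ c ∈ C, p.1 c = c) ∧
    ∃ x, ∀ δ : Γ, ε ≤ dist (δ • p.1 x) (δ • x)

/-- If, for every `n`, elements fixing a finite set `C n` moved no point by `1 / (n + 1)` in the sense
of `FixatorsMove`, then by distality an element fixing all the sets `C n` would be the identity, and
the union of these sets would determine the elements of the group `E(X, Γ)`. -/
theorem exists_fixatorsMove [CompactSpace X] [MulAction.IsMinimal Γ X] (hd : IsDistal Γ X)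
    (h : ¬ IsEquicontinuous Γ X) : ∃ ε > 0, FixatorsMove Γ X ε := by
  by_contra! hno
  have hno' : ∀ n : ℕ, ¬ FixatorsMove Γ X (1 / ((n : ℝ) + 1)) :=
    fun n => hno _ Nat.one_div_pos_of_nat
  unfold FixatorsMove at hno'
  push Not at hno'
  choose C hC hCp using hno'
  refine h (isEquicontinuous_of_determined (fun n => ⋃ k ∈ Set.Iic n, C k)
    (fun n => (Set.finite_Iic n).biUnion fun k _ => hC k)
    (fun m n hmn => Set.biUnion_subset_biUnion_left (Set.Iic_subset_Iic.2 hmn)) ?_)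
  intro p q hpq
  obtain ⟨r, hr, hr'⟩ := hd.exists_mul_eq_one q
  have hrq : ∀ x, r.1 (q.1 x) = x := fun x => congrFun (congrArg Subtype.val hr) x
  have hfix : ∀ n, ∀ c ∈ C n, (r * p).1 c = c := by
    intro n c hc
    change r.1 (p.1 c) = c
    rw [hpq n c (Set.mem_biUnion (Set.mem_Iic.2 le_rfl) hc), hrq]
  have hrp : r * p = 1 := by
    refine Subtype.ext (funext fun x => hd _ _ (proximal_of_forall_exists_dist_lt fun ε hε => ?_))
    obtain ⟨n, hn⟩ := exists_nat_one_div_lt hε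
    obtain ⟨δ, hδ⟩ := hCp n (r * p) (hfix n) x
    exact ⟨δ, hδ.trans hn⟩
  rw [← one_mul p, ← hr', mul_assoc, hrp, mul_one]

/-! ### Separating nearby points simultaneously -/

/-- By minimality, the point moved in `FixatorsMove` can be chosen in a given open set `U`: conjugate
by one of finitely many elements of `Γ`, enough to bring every point into `U`. -/
theorem FixatorsMove.exists_mem_open [CompactSpace X] [MulAction.IsMinimal Γ X] {ε : ℝ}
    (h : FixatorsMove Γ X ε) {C : Set X} (hC : C.Finite) {U : Set X} (hU : IsOpen U)
    (hne : U.Nonempty) :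
    ∃ p : envelopingSemigroup Γ X, (∀ c ∈ C, p.1 c = c) ∧
      ∃ u ∈ U, ∀ δ : Γ, ε ≤ dist (δ • p.1 u) (δ • u) := by
  obtain ⟨I, hI⟩ := isCompact_univ.exists_finite_cover_smul Γ hU hne
  obtain ⟨p, hp, x, hx⟩ := h (⋃ g ∈ I, (fun c : X => g • c) '' C)
    (I.finite_toSet.biUnion fun g _ => hC.image _)
  obtain ⟨g, hg, hxg⟩ := Set.mem_iUnion₂.1 (hI (Set.mem_univ x))
  obtain ⟨u, hu, rfl⟩ := Set.mem_smul_set.1 hxg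
  refine ⟨envelopingSemigroup.of X g⁻¹ * p * envelopingSemigroup.of X g, fun c hc => ?_, u, hu,
    fun δ => ?_⟩
  · change g⁻¹ • p.1 (g • c) = c
    rw [hp _ (Set.mem_biUnion hg ⟨c, hc, rfl⟩), inv_smul_smul]
  · have := hx (δ * g⁻¹)
    rw [mul_smul, mul_smul, inv_smul_smul] at this
    exact this

/-- Finitely many open sets can be treated by one element of the enveloping semigroup: to deal with
an additional open set, multiply `q` if necessary by an element `p` which fixes all the points
considered so far. As `q (p u)` and `q u` are at distance at least `ε`, one of `q` and `q * p`
moves `u` by at least `ε / 2`. -/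
theorem FixatorsMove.exists_forall_mem_open [CompactSpace X] [MulAction.IsMinimal Γ X] {ε : ℝ}
    (h : FixatorsMove Γ X ε) {W : Set X} (hW : W.Finite) {ι : Type*} (U : ι → Set X)
    (hU : ∀ i, IsOpen (U i)) (hne : ∀ i, (U i).Nonempty) (s : Finset ι) :
    ∃ q : envelopingSemigroup Γ X, (∀ w ∈ W, q.1 w = w) ∧
      ∃ u : ι → X, ∀ i ∈ s, u i ∈ U i ∧ ε / 2 ≤ dist (q.1 (u i)) (u i) := by
  classical
  induction s using Finset.induction_on with
  | empty => exact ⟨1, fun _ _ => rfl, fun i => (hne i).some, by simp⟩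
  | insert j s hj ih =>
    obtain ⟨q, hq, u, hu⟩ := ih
    obtain ⟨p, hp, v, hv, hpv⟩ := h.exists_mem_open (hW.union (s.finite_toSet.image u))
      (hU j) (hne j)
    have hqp : ε ≤ dist (q.1 (p.1 v)) (q.1 v) := by
      obtain ⟨F, hF, hlim⟩ := exists_filter_tendsto q
      exact ge_of_tendsto ((hlim (p.1 v)).dist (hlim v)) (Eventually.of_forall hpv)
    -- `r` is `q` or `q * p`; both agree with `q` on the points treated so far
    obtain ⟨r, hr, hrv⟩ : ∃ r : envelopingSemigroup Γ X,
        (∀ c ∈ W ∪ u '' s, r.1 c = q.1 c) ∧ ε / 2 ≤ dist (r.1 v) v := by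
      by_cases hc : ε / 2 ≤ dist (q.1 v) v
      · exact ⟨q, fun _ _ => rfl, hc⟩
      · refine ⟨q * p, fun c hc => congrArg q.1 (hp c hc), ?_⟩
        change ε / 2 ≤ dist (q.1 (p.1 v)) v
        have := dist_triangle_right (q.1 (p.1 v)) (q.1 v) v
        linarith
    refine ⟨r, fun w hw => (hr w (Or.inl hw)).trans (hq w hw), Function.update u j v,
      fun i hi => ?_⟩
    rcases eq_or_ne i j with rfl | hij
    · simpa using ⟨hv, hrv⟩
    · have his : i ∈ s := (Finset.mem_insert.1 hi).resolve_left hij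
      rw [Function.update_of_ne hij, hr _ (Or.inr ⟨i, his, rfl⟩)]
      exact hu i his

/-- Given finitely many nonempty open sets, a single element of `Γ` separates two points in each of
them. -/
theorem FixatorsMove.exists_smul_separating [CompactSpace X] [MulAction.IsMinimal Γ X] {ε : ℝ}
    (hε : 0 < ε) (h : FixatorsMove Γ X ε) {ι : Type*} [Finite ι] (U : ι → Set X)
    (hU : ∀ i, IsOpen (U i)) (hne : ∀ i, (U i).Nonempty) :
    ∃ (γ : Γ) (w u : ι → X), ∀ i, w i ∈ U i ∧ u i ∈ U i ∧ ε / 4 < dist (γ • u i) (γ • w i) := by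
  have := Fintype.ofFinite ι
  choose w hw using hne
  obtain ⟨q, hq, u, hu⟩ := h.exists_forall_mem_open (Set.finite_range w)
    (fun i => U i ∩ Metric.ball (w i) (ε / 16)) (fun i => (hU i).inter Metric.isOpen_ball)
    (fun i => ⟨w i, hw i, Metric.mem_ball_self (by positivity)⟩) Finset.univ
  obtain ⟨γ, hγ⟩ := exists_forall_dist_smul_lt q
    ((Set.finite_range w).union (Set.finite_range u)) (ε := ε / 16) (by positivity)
  refine ⟨γ, w, u, fun i => ⟨hw i, (hu i (Finset.mem_univ i)).1.1, ?_⟩⟩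
  have h1 := hγ (u i) (Or.inr ⟨i, rfl⟩)
  have h2 := hγ (w i) (Or.inl ⟨i, rfl⟩)
  rw [hq _ ⟨i, rfl⟩] at h2
  have h3 := Metric.mem_ball.1 (hu i (Finset.mem_univ i)).1.2
  have h4 := (hu i (Finset.mem_univ i)).2
  have h5 := dist_triangle4 (q.1 (u i)) (γ • u i) (γ • w i) (w i)
  have h6 := dist_triangle_right (q.1 (u i)) (u i) (w i)
  have h7 := dist_triangle (q.1 (u i)) (w i) (u i)
  rw [dist_comm (q.1 (u i)) (γ • u i)] at h5
  rw [dist_comm (w i)] at h7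
  linarith

end Metric

section Measures

open scoped NNReal ENNReal BoundedContinuousFunction

variable {Γ X : Type*} [Group Γ] [MetricSpace X] [MeasurableSpace X] [BorelSpace X]

/-! ### Integrals and finite combinations of probability measures -/

theorem probabilityMeasure_ext {μ ν : ProbabilityMeasure X}
    (h : ∀ f : X →ᵇ ℝ, ∫ x, f x ∂(μ : Measure X) = ∫ x, f x ∂(ν : Measure X)) : μ = ν :=
  Subtype.ext (ext_of_forall_integral_eq_of_IsFiniteMeasure (μ := (μ : Measure X))
    (ν := (ν : Measure X)) h)

variable [CompactSpace X] [MulAction Γ X] [ContinuousConstSMul Γ X]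
theorem integrable_of_continuous {E : Type*} [NormedAddCommGroup E] {f : X → E}
    (hf : Continuous f) (μ : Measure X) [IsFiniteMeasure μ] : Integrable f μ :=
  hf.integrable_of_hasCompactSupport (HasCompactSupport.of_compactSpace f)

theorem continuous_integral_probabilityMeasure {f : X → ℝ} (hf : Continuous f) :
    Continuous fun μ : ProbabilityMeasure X => ∫ x, f x ∂(μ : Measure X) :=
  ProbabilityMeasure.continuous_integral_boundedContinuousFunction
    (BoundedContinuousFunction.mkOfCompact ⟨f, hf⟩)

theorem integral_smul_probabilityMeasure {E : Type*} [NormedAddCommGroup E] [NormedSpace ℝ E]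
    {f : X → E} (hf : Continuous f) (γ : Γ) (μ : ProbabilityMeasure X) :
    ∫ x, f x ∂((γ • μ : ProbabilityMeasure X) : Measure X)
      = ∫ x, f (γ • x) ∂(μ : Measure X) := by
  rw [smul_probabilityMeasure_def, ProbabilityMeasure.toMeasure_map]
  exact integral_map (aemeasurable_smul γ _)
    (integrable_of_continuous hf _).aestronglyMeasurable

theorem integral_finset_combination {ι : Type*} {s : Finset ι} {a : ι → ℝ≥0}
    {ν : ι → ProbabilityMeasure X} {μ : Measure X} (h : μ = ∑ i ∈ s, a i • (ν i : Measure X))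
    {f : X → ℝ} (hf : Continuous f) :
    ∫ x, f x ∂μ = ∑ i ∈ s, (a i : ℝ) * ∫ x, f x ∂(ν i : Measure X) := by
  rw [h, integral_finsetSum_measure fun i _ => integrable_of_continuous hf _]
  exact Finset.sum_congr rfl fun i _ => integral_smul_nnreal_measure _ _

/-- The elements of `E(M(X), Γ)` are affine maps. -/
theorem envelopingSemigroup_apply_combination (p : envelopingSemigroup Γ (ProbabilityMeasure X))
    {ι : Type*} {s : Finset ι} {a : ι → ℝ≥0} {ν : ι → ProbabilityMeasure X}
    {μ : ProbabilityMeasure X} (h : (μ : Measure X) = ∑ i ∈ s, a i • (ν i : Measure X)) :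
    (p.1 μ : Measure X) = ∑ i ∈ s, a i • (p.1 (ν i) : Measure X) := by
  have : IsFiniteMeasure (∑ i ∈ s, a i • (p.1 (ν i) : Measure X)) := inferInstance
  refine ext_of_forall_integral_eq_of_IsFiniteMeasure fun f => ?_
  rw [integral_finset_combination rfl f.continuous]
  obtain ⟨F, hF, hlim⟩ := exists_filter_tendsto p
  have hl : ∀ κ : ProbabilityMeasure X, Tendsto (fun γ : Γ => ∫ x, f (γ • x) ∂(κ : Measure X)) F
      (𝓝 (∫ x, f x ∂(p.1 κ : Measure X))) := by
    intro κ
    have := ((continuous_integral_probabilityMeasure f.continuous).tendsto (p.1 κ)).comp (hlim κ)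
    refine this.congr fun γ => ?_
    exact integral_smul_probabilityMeasure f.continuous γ κ
  refine tendsto_nhds_unique (hl μ) ?_
  refine (tendsto_finsetSum s fun i _ => (hl (ν i)).const_mul (a i : ℝ)).congr fun γ => ?_
  exact (integral_finset_combination h (f.continuous.comp (continuous_const_smul γ))).symm

/-- A probability measure is a finite combination of probability measures `ν z`, each of which is
concentrated near the point `z`: cut `X` into finitely many small Borel pieces and normalize the
restrictions. -/
theorem exists_small_decomposition (μ : ProbabilityMeasure X) {ε : ℝ} (hε : 0 < ε) :
    ∃ (s : Finset X) (a : X → ℝ≥0) (ν : X → ProbabilityMeasure X),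
      (μ : Measure X) = ∑ z ∈ s, a z • (ν z : Measure X) ∧
      ∀ z, ∫ x, dist x z ∂(ν z : Measure X) ≤ ε := by
  classical
  have : Nonempty X := μ.nonempty
  let e := TopologicalSpace.denseSeq X
  obtain ⟨t, ht⟩ := isCompact_univ.elim_finite_subcover (fun k => Metric.ball (e k) ε)
    (fun k => Metric.isOpen_ball) (fun x _ => by
      obtain ⟨k, hk⟩ := (TopologicalSpace.denseRange_denseSeq X).exists_dist_lt x hε
      exact Set.mem_iUnion.2 ⟨k, hk⟩)
  let g := SimpleFunc.nearestPt e (t.sup id)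
  have hg : ∀ x, dist x (g x) ≤ ε := by
    intro x
    obtain ⟨k, hk, hxk⟩ := Set.mem_iUnion₂.1 (ht (Set.mem_univ x))
    have h1 := SimpleFunc.edist_nearestPt_le e x (Finset.le_sup (f := id) hk)
    rw [edist_dist, edist_dist, ENNReal.ofReal_le_ofReal_iff dist_nonneg] at h1
    rw [dist_comm]
    exact h1.trans ((dist_comm _ _).trans_le (Metric.mem_ball.1 hxk).le)
  have key : ∀ z, ∃ ν : ProbabilityMeasure X,
      μ (g ⁻¹' {z}) • (ν : Measure X) = (μ : Measure X).restrict (g ⁻¹' {z}) ∧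
      ∀ᵐ x ∂(ν : Measure X), dist x z ≤ ε := by
    intro z
    have hcoe : ∀ ν : Measure X, μ (g ⁻¹' {z}) • ν = (μ : Measure X) (g ⁻¹' {z}) • ν := fun ν => by
      rw [← ProbabilityMeasure.ennreal_coeFn_eq_coeFn_toMeasure]
      rfl
    by_cases h : (μ : Measure X) (g ⁻¹' {z}) = 0
    · refine ⟨diracProba z, by rw [hcoe, h, zero_smul, Measure.restrict_eq_zero.2 h], ?_⟩
      change ∀ᵐ x ∂(Measure.dirac z), dist x z ≤ ε
      rw [ae_dirac_iff (measurableSet_le (by fun_prop) measurable_const), dist_self]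
      exact hε.le
    · refine ⟨⟨ProbabilityTheory.cond (μ : Measure X) (g ⁻¹' {z}),
        ProbabilityTheory.cond_isProbabilityMeasure h⟩, ?_, ?_⟩
      · rw [hcoe]
        change _ • (_ • _) = _
        rw [smul_smul, ENNReal.mul_inv_cancel h (measure_ne_top _ _), one_smul]
      · change ∀ᵐ x ∂(ProbabilityTheory.cond (μ : Measure X) (g ⁻¹' {z})), dist x z ≤ ε
        filter_upwards [ProbabilityTheory.ae_cond_mem (g.measurableSet_fiber z)] with x hx
        have hx' : g x = z := hx
        simpa [hx'] using hg x
  choose ν hν hae using key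
  refine ⟨g.range, fun z => μ (g ⁻¹' {z}), ν, ?_, fun z => ?_⟩
  · simp only [hν]
    refine Measure.ext fun A hA => ?_
    rw [Measure.finsetSum_apply]
    simp only [Measure.restrict_apply hA]
    have := sum_measure_preimage_singleton (μ := (μ : Measure X).restrict A) g.range (f := g)
      fun y _ => g.measurableSet_fiber y
    simp only [Measure.restrict_apply (g.measurableSet_fiber _)] at this
    rw [SimpleFunc.coe_range, Set.preimage_range, Measure.restrict_apply_univ] at this
    rw [← this]
    exact Finset.sum_congr rfl fun z _ => by rw [Set.inter_comm]
  · have h1 := integral_mono_ae (integrable_of_continuous (by fun_prop) _)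
      (integrable_const ε) (hae z)
    simpa using h1

/-! ### Total boundedness of the acting group in measure -/

/-- If `p` inverts `q` in `E(M(X), Γ)`, then the decomposition of `q m` into pieces `ν z`
concentrated near points `z` pulls back to a decomposition of `m` into pieces `p (ν z)`. A
translation `γ` close to `q` carries `p (ν z)` near `z` for all `z`, so that two such translations
are close to each other in `m`-mean. -/
theorem exists_open_integral_dist_lt
    (hinv : ∀ q : envelopingSemigroup Γ (ProbabilityMeasure X), ∃ p, p * q = 1 ∧ q * p = 1)
    (m : ProbabilityMeasure X) {c : ℝ} (hc : 0 < c)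
    (q : envelopingSemigroup Γ (ProbabilityMeasure X)) :
    ∃ O ∈ 𝓝 q, ∀ γ γ' : Γ, envelopingSemigroup.of _ γ ∈ O → envelopingSemigroup.of _ γ' ∈ O →
      ∫ x, dist (γ • x) (γ' • x) ∂(m : Measure X) < c := by
  obtain ⟨p, hpq, hqp⟩ := hinv q
  have hpq' : ∀ κ, p.1 (q.1 κ) = κ := fun κ => congrFun (congrArg Subtype.val hpq) κ
  have hqp' : ∀ κ, q.1 (p.1 κ) = κ := fun κ => congrFun (congrArg Subtype.val hqp) κ
  obtain ⟨s, a, ν, hν, hsmall⟩ := exists_small_decomposition (q.1 m) (ε := c / 8) (by positivity)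
  have hm := envelopingSemigroup_apply_combination p hν
  rw [hpq'] at hm
  have ha : ∑ z ∈ s, (a z : ℝ) = 1 := by
    simpa using (integral_finset_combination hm (f := fun _ => (1 : ℝ)) continuous_const).symm
  refine ⟨{r | ∀ z ∈ s, ∫ x, dist x z ∂(r.1 (p.1 (ν z)) : Measure X) < c / 4},
    (eventually_all_finset s).2 fun z _ => ?_, fun γ γ' hγ hγ' => ?_⟩
  · have hcont : Continuous fun r : envelopingSemigroup Γ (ProbabilityMeasure X) =>
        ∫ x, dist x z ∂(r.1 (p.1 (ν z)) : Measure X) :=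
      (continuous_integral_probabilityMeasure (by fun_prop)).comp
        (continuous_envelopingSemigroup_apply _)
    refine hcont.continuousAt.eventually_lt_const
      (lt_of_le_of_lt ?_ (show c / 8 < c / 4 by linarith))
    exact (congrArg (fun κ : ProbabilityMeasure X => ∫ x, dist x z ∂(κ : Measure X))
      (hqp' (ν z))).trans_le (hsmall z)
  · have hbound : ∀ z ∈ s,
        ∫ x, dist (γ • x) (γ' • x) ∂(p.1 (ν z) : Measure X) ≤ c / 2 := by
      intro z hz
      have h1 : ∫ x, dist (γ • x) z ∂(p.1 (ν z) : Measure X) < c / 4 := by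
        rw [← integral_smul_probabilityMeasure (f := fun x => dist x z) (by fun_prop)]
        exact hγ z hz
      have h2 : ∫ x, dist (γ' • x) z ∂(p.1 (ν z) : Measure X) < c / 4 := by
        rw [← integral_smul_probabilityMeasure (f := fun x => dist x z) (by fun_prop)]
        exact hγ' z hz
      have i1 := integrable_of_continuous (f := fun x : X => dist (γ • x) z)
        (by fun_prop) (p.1 (ν z) : Measure X)
      have i2 := integrable_of_continuous (f := fun x : X => dist (γ' • x) z)
        (by fun_prop) (p.1 (ν z) : Measure X)
      have h3 := integral_mono (integrable_of_continuous
        (f := fun x : X => dist (γ • x) (γ' • x)) (by fun_prop) (p.1 (ν z) : Measure X))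
        (i1.add i2) fun x => dist_triangle_right (γ • x) (γ' • x) z
      simp only [Pi.add_apply] at h3
      rw [integral_add i1 i2] at h3
      linarith
    rw [integral_finset_combination hm (f := fun x => dist (γ • x) (γ' • x)) (by fun_prop)]
    calc ∑ z ∈ s, (a z : ℝ) * ∫ x, dist (γ • x) (γ' • x) ∂(p.1 (ν z) : Measure X)
        ≤ ∑ z ∈ s, (a z : ℝ) * (c / 2) :=
          Finset.sum_le_sum fun z hz => mul_le_mul_of_nonneg_left (hbound z hz) (a z).2
      _ < c := by
          rw [← Finset.sum_mul, ha]
          linarith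

/-- If `E(M(X), Γ)` is a group, then `Γ` is totally bounded for the distance in `m`-mean. -/
theorem exists_card_bound
    (hinv : ∀ q : envelopingSemigroup Γ (ProbabilityMeasure X), ∃ p, p * q = 1 ∧ q * p = 1)
    (m : ProbabilityMeasure X) {c : ℝ} (hc : 0 < c) :
    ∃ N : ℕ, ∀ S : Finset Γ, N < S.card → ∃ γ ∈ S, ∃ γ' ∈ S, γ ≠ γ' ∧
      ∫ x, dist (γ • x) (γ' • x) ∂(m : Measure X) < c := by
  choose O hO hclose using exists_open_integral_dist_lt hinv m hc
  obtain ⟨t, ht⟩ := CompactSpace.elim_nhds_subcover O hO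
  have hcov : ∀ γ : Γ, ∃ q ∈ t, envelopingSemigroup.of (ProbabilityMeasure X) γ ∈ O q := fun γ =>
    by simpa using ht.ge (Set.mem_univ (envelopingSemigroup.of (ProbabilityMeasure X) γ))
  choose f hft hf using hcov
  refine ⟨t.card, fun S hS => ?_⟩
  obtain ⟨γ, hγ, γ', hγ', hne, heq⟩ :=
    Finset.exists_ne_map_eq_of_card_lt_of_maps_to hS fun γ _ => hft γ
  exact ⟨γ, hγ, γ', hγ', hne, hclose (f γ) γ γ' (hf γ) (heq ▸ hf γ')⟩

/-! ### Generic measures -/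

/-- The measure with mass `a i` at the point `x i`. -/
noncomputable def discreteProba {ι : Type*} [Fintype ι] (a : ι → ℝ≥0) (ha : ∑ i, a i = 1)
    (x : ι → X) : ProbabilityMeasure X :=
  ⟨∑ i, a i • (diracProba (x i) : Measure X), ⟨by
    rw [Measure.finsetSum_apply]
    simp only [Measure.smul_apply, measure_univ, ENNReal.smul_def, smul_eq_mul, mul_one]
    rw [← ENNReal.ofNNReal_finsetSum, ha, ENNReal.coe_one]⟩⟩

theorem integral_discreteProba {ι : Type*} [Fintype ι] (a : ι → ℝ≥0) (ha : ∑ i, a i = 1)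
    (x : ι → X) {f : X → ℝ} (hf : Continuous f) :
    ∫ y, f y ∂(discreteProba a ha x : Measure X) = ∑ i, (a i : ℝ) * f (x i) := by
  refine (integral_finset_combination (s := Finset.univ) (a := a)
    (ν := fun i => diracProba (x i)) rfl hf).trans ?_
  exact Finset.sum_congr rfl fun i _ => congrArg _ (integral_dirac f (x i))

theorem continuous_discreteProba {ι : Type*} [Fintype ι] (a : ι → ℝ≥0) (ha : ∑ i, a i = 1) :
    Continuous (discreteProba (X := X) a ha) := by
  refine continuous_iff_continuousAt.2 fun x =>
    ProbabilityMeasure.tendsto_iff_forall_integral_tendsto.2 fun f => ?_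
  simp only [integral_discreteProba a ha _ f.continuous]
  exact Continuous.tendsto (by fun_prop) x

/-- Finitely supported measures are dense: push a measure forward by the simple functions that send
`x` to a point nearest to it among the first terms of a dense sequence. -/
theorem exists_discreteProba_mem {W : Set (ProbabilityMeasure X)} (hW : IsOpen W)
    (hne : W.Nonempty) :
    ∃ (s : Finset X) (a : s → ℝ≥0) (ha : ∑ i, a i = 1), discreteProba a ha (fun i => i.1) ∈ W := by
  obtain ⟨μ, hμ⟩ := hne
  have : Nonempty X := μ.nonempty
  let g := SimpleFunc.nearestPt (TopologicalSpace.denseSeq X)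
  have hlim : Tendsto (fun N => μ.map (g N).measurable.aemeasurable) atTop (𝓝 μ) := by
    refine ProbabilityMeasure.tendsto_iff_forall_integral_tendsto.2 fun f => ?_
    have : ∀ N, ∫ x, f x ∂(μ.map (g N).measurable.aemeasurable : Measure X)
        = ∫ x, f (g N x) ∂(μ : Measure X) := fun N => by
      rw [ProbabilityMeasure.toMeasure_map]
      exact integral_map (g N).measurable.aemeasurable
        f.continuous.aestronglyMeasurable
    simp only [this]
    refine tendsto_integral_of_dominated_convergence (fun _ => ‖f‖)
      (fun N => (f.continuous.measurable.comp (g N).measurable).aestronglyMeasurable)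
      (integrable_const _) (fun N => Eventually.of_forall fun x => f.norm_coe_le_norm _)
      (Eventually.of_forall fun x => (f.continuous.tendsto x).comp
        (SimpleFunc.tendsto_nearestPt (TopologicalSpace.denseRange_denseSeq X x)))
  obtain ⟨N, hN⟩ := (hlim.eventually (hW.mem_nhds hμ)).exists
  let a : (g N).range → ℝ≥0 := fun z => μ (g N ⁻¹' {z.1})
  have hsum : ∀ A : Set X, MeasurableSet A →
      ∑ z : (g N).range, (a z : ℝ≥0∞) * A.indicator 1 z.1 = (μ : Measure X) (g N ⁻¹' A) := by
    classical
    intro A hA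
    rw [Finset.sum_coe_sort (g N).range
      (fun z => ((μ (g N ⁻¹' {z}) : ℝ≥0) : ℝ≥0∞) * A.indicator 1 z)]
    simp only [ProbabilityMeasure.ennreal_coeFn_eq_coeFn_toMeasure, Set.indicator_apply,
      Pi.one_apply, mul_ite, mul_one, mul_zero]
    rw [← Finset.sum_filter, sum_measure_preimage_singleton (f := g N)
      ((g N).range.filter (· ∈ A)) fun y _ => (g N).measurableSet_fiber y]
    congr 1
    ext x
    simp
  have ha : ∑ i, a i = 1 := by
    have := hsum Set.univ MeasurableSet.univ
    simp only [Set.indicator_univ, Pi.one_apply, mul_one, Set.preimage_univ, measure_univ] at this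
    exact_mod_cast this
  refine ⟨(g N).range, a, ha, ?_⟩
  suffices heq : discreteProba a ha (fun i => i.1) = μ.map (g N).measurable.aemeasurable by
    rw [heq]
    exact hN
  refine Subtype.ext ?_
  change (discreteProba a ha (fun i => i.1) : Measure X)
    = (μ.map (g N).measurable.aemeasurable : Measure X)
  refine Measure.ext fun A hA => ?_
  rw [ProbabilityMeasure.toMeasure_map, Measure.map_apply (g N).measurable hA, ← hsum A hA]
  change (∑ i, a i • (diracProba (i.1 : X) : Measure X)) A = _
  rw [Measure.finsetSum_apply]
  refine Finset.sum_congr rfl fun i _ => ?_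
  change (a i : ℝ≥0∞) • Measure.dirac i.1 A = _
  rw [Measure.dirac_apply' _ hA, smul_eq_mul]

/-- Given finitely many elements of `Γ`, every measure can be perturbed so that some `γ` is at
distance more than `ε / 32` from each of them in mean: replace the measure by one with finitely many
atoms, split each atom in two nearby halves which are not distinguished by the given elements, and
let `γ` separate the halves. -/
theorem FixatorsMove.exists_separated_measure [MulAction.IsMinimal Γ X] {ε : ℝ} (hε : 0 < ε)
    (h : FixatorsMove Γ X ε) (S : Finset Γ) {W : Set (ProbabilityMeasure X)} (hW : IsOpen W)
    (hne : W.Nonempty) :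
    ∃ m ∈ W, ∃ γ : Γ, ∀ g ∈ S, ε / 32 < ∫ x, dist (γ • x) (g • x) ∂(m : Measure X) := by
  obtain ⟨s, a, ha, hmem⟩ := exists_discreteProba_mem hW hne
  let b : s × Bool → ℝ≥0 := fun j => a j.1 / 2
  have hb : ∑ j, b j = 1 := by
    simp only [b, Fintype.sum_prod_type, Fintype.sum_bool, add_halves, ha]
  have hbW : discreteProba b hb (fun j => (j.1 : X)) ∈ W := by
    convert hmem using 1
    refine probabilityMeasure_ext fun f => ?_
    refine (integral_discreteProba b hb _ f.continuous).trans
      (Eq.trans ?_ (integral_discreteProba a ha _ f.continuous).symm)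
    rw [Fintype.sum_prod_type]
    refine Finset.sum_congr rfl fun i _ => ?_
    simp only [b, Fintype.sum_bool, NNReal.coe_div, NNReal.coe_ofNat]
    ring
  obtain ⟨r, hr, hball⟩ := Metric.isOpen_iff.1 (hW.preimage (continuous_discreteProba b hb)) _ hbW
  obtain ⟨γ, w, u, hwu⟩ := h.exists_smul_separating hε
    (fun i : s => Metric.ball (i : X) (r / 2) ∩
      ⋂ g ∈ S, (fun x : X => g • x) ⁻¹' Metric.ball (g • (i : X)) (ε / 16))
    (fun i => Metric.isOpen_ball.inter (isOpen_biInter_finset fun g _ =>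
      Metric.isOpen_ball.preimage (continuous_const_smul g)))
    (fun i => ⟨i, Metric.mem_ball_self (half_pos hr), Set.mem_iInter₂.2 fun g _ =>
      Metric.mem_ball_self (by positivity)⟩)
  -- each atom `i` is replaced by the two atoms `w i` and `u i` with half of its mass
  let y : s × Bool → X := fun j => bif j.2 then w j.1 else u j.1
  refine ⟨discreteProba b hb y, hball (Metric.mem_ball.2 ?_), γ, fun g hg => ?_⟩
  · refine lt_of_le_of_lt ((dist_pi_le_iff (half_pos hr).le).2 ?_) (half_lt_self hr)
    rintro ⟨i, β⟩
    cases β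
    · exact (Metric.mem_ball.1 (hwu i).2.1.1).le
    · exact (Metric.mem_ball.1 (hwu i).1.1).le
  · rw [integral_discreteProba b hb y (f := fun x => dist (γ • x) (g • x)) (by fun_prop),
      Fintype.sum_prod_type]
    have hi : ∀ i : s, (a i : ℝ) * (ε / 16) ≤
        ∑ β : Bool, (b (i, β) : ℝ) * dist (γ • y (i, β)) (g • y (i, β)) := by
      intro i
      have h1 := Metric.mem_ball.1 (Set.mem_iInter₂.1 (hwu i).1.2 g hg)
      have h2 := Metric.mem_ball.1 (Set.mem_iInter₂.1 (hwu i).2.1.2 g hg)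
      have h3 := (hwu i).2.2
      have h4 := dist_triangle4 (γ • u i) (g • u i) (g • w i) (γ • w i)
      have h5 := dist_triangle_right (g • u i) (g • w i) (g • (i : X))
      rw [dist_comm (g • w i) (γ • w i)] at h4
      have h6 : ε / 8 ≤ dist (γ • u i) (g • u i) + dist (γ • w i) (g • w i) := by linarith
      simp only [b, y, Fintype.sum_bool, NNReal.coe_div, NNReal.coe_ofNat, cond_true, cond_false]
      nlinarith [mul_le_mul_of_nonneg_left h6 (a i).2]
    refine lt_of_lt_of_le ?_ (Finset.sum_le_sum fun i _ => hi i)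
    have ha' : ∑ i, (a i : ℝ) = 1 := by exact_mod_cast ha
    rw [← Finset.sum_mul, ha']
    linarith

/-- The measures for which `Γ` contains `N` elements that are `c`-separated in mean. -/
def separatedMeasures (Γ : Type*) {X : Type*} [Group Γ] [MetricSpace X] [MeasurableSpace X]
    [MulAction Γ X] (c : ℝ) (N : ℕ) : Set (ProbabilityMeasure X) :=
  {m | ∃ S : Finset Γ, S.card = N ∧ ∀ γ ∈ S, ∀ γ' ∈ S, γ ≠ γ' →
    c < ∫ x, dist (γ • x) (γ' • x) ∂(m : Measure X)}

theorem isOpen_separatedMeasures_of_finset (c : ℝ) (S : Finset Γ) :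
    IsOpen {m : ProbabilityMeasure X | ∀ γ ∈ S, ∀ γ' ∈ S, γ ≠ γ' →
      c < ∫ x, dist (γ • x) (γ' • x) ∂(m : Measure X)} := by
  simp only [Set.ofPred_forall]
  refine isOpen_biInter_finset fun γ _ => isOpen_biInter_finset fun γ' _ =>
    isOpen_iInter_of_finite fun _ => ?_
  exact isOpen_lt continuous_const (continuous_integral_probabilityMeasure (by fun_prop))

theorem isOpen_separatedMeasures (c : ℝ) (N : ℕ) :
    IsOpen (separatedMeasures Γ (X := X) c N) := by
  refine isOpen_iff_forall_mem_open.2 ?_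
  rintro m ⟨S, hS, hm⟩
  exact ⟨_, fun m' hm' => ⟨S, hS, hm'⟩, isOpen_separatedMeasures_of_finset c S, hm⟩

theorem FixatorsMove.dense_separatedMeasures [MulAction.IsMinimal Γ X] {ε : ℝ} (hε : 0 < ε)
    (h : FixatorsMove Γ X ε) (N : ℕ) : Dense (separatedMeasures Γ (X := X) (ε / 32) N) := by
  classical
  induction N with
  | zero => exact dense_univ.mono fun m _ => ⟨∅, rfl, by simp⟩
  | succ N ih =>
    refine dense_iff_inter_open.2 fun W hW hne => ?_
    obtain ⟨m, hmW, S, hS, hm⟩ := dense_iff_inter_open.1 ih W hW hne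
    obtain ⟨m', ⟨hm'W, hm'⟩, γ, hγ⟩ := h.exists_separated_measure hε S
      (hW.inter (isOpen_separatedMeasures_of_finset (ε / 32) S)) ⟨m, hmW, hm⟩
    have hγS : γ ∉ S := fun hmem => by
      have := hγ γ hmem
      simp only [dist_self, integral_zero] at this
      linarith
    refine ⟨m', hm'W, insert γ S, by rw [Finset.card_insert_of_notMem hγS, hS], ?_⟩
    intro g hg g' hg' hgg
    rcases Finset.mem_insert.1 hg with rfl | hgS <;> rcases Finset.mem_insert.1 hg' with rfl | hgS'
    · exact absurd rfl hgg
    · exact hγ g' hgS'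
    · simp only [dist_comm (g • _)]
      exact hγ g hgS
    · exact hm' g hgS g' hgS' hgg

/-- A minimal distal system for which `E(M(X), Γ)` is a group is equicontinuous: otherwise, by the
Baire category theorem, some measure makes `Γ` fail to be totally bounded in mean. -/
theorem isEquicontinuous_of_invertible [MulAction.IsMinimal Γ X] (hd : IsDistal Γ X)
    (hinv : ∀ q : envelopingSemigroup Γ (ProbabilityMeasure X), ∃ p, p * q = 1 ∧ q * p = 1) :
    IsEquicontinuous Γ X := by
  rcases isEmpty_or_nonempty X with hX | ⟨⟨x₀⟩⟩
  · exact Metric.uniformEquicontinuous_iff.2 fun ε hε => ⟨1, one_pos, fun x => (hX.false x).elim⟩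
  by_contra hne
  obtain ⟨ε, hε, h⟩ := exists_fixatorsMove hd hne
  have : Nonempty (ProbabilityMeasure X) := ⟨diracProba x₀⟩
  obtain ⟨m, hm⟩ := (dense_iInter_of_isOpen_nat
    (fun N => isOpen_separatedMeasures (Γ := Γ) (X := X) (ε / 32) N)
    (h.dense_separatedMeasures hε)).nonempty
  obtain ⟨N, hN⟩ := exists_card_bound hinv m (c := ε / 32) (by positivity)
  obtain ⟨S, hS, hsep⟩ := Set.mem_iInter.1 hm (N + 1)
  obtain ⟨γ, hγ, γ', hγ', hγγ, hlt⟩ := hN S (by omega)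
  exact absurd (hsep γ hγ γ' hγ' hγγ) (not_lt.2 hlt.le)

end Measures

/-! ### Isomorphisms and restriction maps -/

theorem isIsomorphism_of_bijective {E F : Type*} [Monoid E] [TopologicalSpace E] [Monoid F]
    [TopologicalSpace F] [CompactSpace E] [T2Space F] (Φ : E →ₜ* F)
    (h : Function.Bijective Φ) : IsIsomorphism Φ := by
  let e : E ≃* F := MulEquiv.ofBijective Φ h
  have he : Continuous e.toEquiv := Φ.continuous_toFun
  exact ⟨{ e with
    continuous_toFun := he
    continuous_invFun := (Continuous.homeoOfEquivCompactToT2 he).symm.continuous }, fun _ => rfl⟩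

theorem restrict_surjective {Γ X Y : Type*} [Group Γ] [TopologicalSpace X] [T2Space X]
    [MulAction Γ X] [ContinuousConstSMul Γ X] [TopologicalSpace Y] [MulAction Γ Y]
    [ContinuousConstSMul Γ Y] [CompactSpace (envelopingSemigroup Γ Y)] (i : X → Y)
    (hi : IsClosedEmbedding i) (hΓ : ∀ (γ : Γ) (x : X), i (γ • x) = γ • i x) :
    Function.Surjective (restrict i hi hΓ) := by
  have hc : IsClosed (Set.range (restrict i hi hΓ)) :=
    (isCompact_range (restrict i hi hΓ).continuous_toFun).isClosed
  refine Set.range_eq_univ.1 (Set.eq_univ_of_univ_subset ?_)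
  rw [← (denseRange_of (Γ := Γ) (Y := X)).closure_range]
  refine closure_minimal ?_ hc
  rintro _ ⟨γ, rfl⟩
  exact ⟨envelopingSemigroup.of Y γ, restrict_of i hi hΓ γ⟩

section Measures

open scoped BoundedContinuousFunction

variable {Γ X : Type*} [Group Γ] [MetricSpace X] [CompactSpace X] [MeasurableSpace X]
  [BorelSpace X] [MulAction Γ X] [ContinuousConstSMul Γ X]

theorem isInjectiveSystem_of_injective (h : Function.Injective (naturalMap Γ X)) :
    IsInjectiveSystem Γ X :=
  isIsomorphism_of_bijective _ ⟨h, restrict_surjective _ _ _⟩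

/-- Along a filter converging to `p` in `E(M(X), Γ)` the translations of `X` converge pointwise to
the image of `p`. -/
theorem tendsto_smul_naturalMap (p : envelopingSemigroup Γ (ProbabilityMeasure X)) {F : Filter Γ}
    (hF : ∀ m, Tendsto (fun γ : Γ => γ • m) F (𝓝 (p.1 m))) (x : X) :
    Tendsto (fun γ : Γ => γ • x) F (𝓝 ((naturalMap Γ X p).1 x)) := by
  refine (isClosedEmbedding_dirac (X := X)).isInducing.tendsto_nhds_iff.2 ?_
  have h1 := hF (diracProba x)
  rw [← restrict_spec (fun x : X => diracProba x) isClosedEmbedding_dirac dirac_smul p x] at h1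
  exact h1.congr fun γ => (dirac_smul γ x).symm

/-! ### Equicontinuous systems are injective -/

/-- In an equicontinuous system, two translations which are close on a finite net are uniformly
close, hence have close effects on every measure. -/
theorem IsEquicontinuous.injective_naturalMap (h : IsEquicontinuous Γ X) :
    Function.Injective (naturalMap Γ X) := by
  intro p q hpq
  refine Subtype.ext (funext fun m => probabilityMeasure_ext fun f => ?_)
  refine eq_of_forall_dist_le fun ε hε => ?_
  obtain ⟨δ, hδ, hf⟩ := Metric.uniformContinuous_iff.1
    (CompactSpace.uniformContinuous_of_continuous f.continuous) (ε / 3) (by positivity)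
  obtain ⟨η, hη, hequi⟩ := Metric.uniformEquicontinuous_iff.1 h (δ / 4) (by positivity)
  obtain ⟨t, -, htf, ht⟩ := Metric.finite_approx_of_totallyBounded
    (isCompact_univ (X := X)).totallyBounded η hη
  have approx : ∀ r : envelopingSemigroup Γ (ProbabilityMeasure X), ∃ γ : Γ,
      (∀ x ∈ t, dist (γ • x) ((naturalMap Γ X r).1 x) < δ / 4) ∧
      dist (∫ x, f (γ • x) ∂(m : Measure X)) (∫ x, f x ∂(r.1 m : Measure X)) < ε / 3 := by
    intro r
    obtain ⟨F, hF, hlim⟩ := exists_filter_tendsto r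
    have h1 := (eventually_all_finite htf).2 fun x _ =>
      Metric.tendsto_nhds.1 (tendsto_smul_naturalMap r hlim x) (δ / 4) (by positivity)
    have h2 := Metric.tendsto_nhds.1
      (((continuous_integral_probabilityMeasure f.continuous).tendsto (r.1 m)).comp (hlim m))
      (ε / 3) (by positivity)
    obtain ⟨γ, hγ1, hγ2⟩ := (h1.and h2).exists
    refine ⟨γ, hγ1, ?_⟩
    rw [← integral_smul_probabilityMeasure f.continuous]
    exact hγ2
  obtain ⟨γ, hγ, hγm⟩ := approx p
  obtain ⟨γ', hγ', hγm'⟩ := approx q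
  have hclose : ∀ x : X, dist (γ • x) (γ' • x) < δ := by
    intro x
    obtain ⟨z, hz, hxz⟩ := Set.mem_iUnion₂.1 (ht (Set.mem_univ x))
    have h1 := hγ z hz
    have h2 := hγ' z hz
    rw [← hpq] at h2
    have h3 := hequi x z hxz γ
    have h4 := hequi x z hxz γ'
    have h5 := dist_triangle4 (γ • x) (γ • z) (γ' • z) (γ' • x)
    have h6 := dist_triangle_right (γ • z) (γ' • z) ((naturalMap Γ X p).1 z)
    rw [dist_comm (γ' • z) (γ' • x)] at h5
    linarith
  have hint : dist (∫ x, f (γ • x) ∂(m : Measure X)) (∫ x, f (γ' • x) ∂(m : Measure X))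
      ≤ ε / 3 := by
    rw [dist_eq_norm, ← integral_sub
      (integrable_of_continuous (f := fun x => f (γ • x)) (by fun_prop) _)
      (integrable_of_continuous (f := fun x => f (γ' • x)) (by fun_prop) _)]
    refine (norm_integral_le_of_norm_le_const (C := ε / 3)
      (Eventually.of_forall fun x => ?_)).trans (by simp)
    rw [← dist_eq_norm]
    exact (hf (hclose x)).le
  have := dist_triangle4 (∫ x, f x ∂(p.1 m : Measure X)) (∫ x, f (γ • x) ∂(m : Measure X))
    (∫ x, f (γ' • x) ∂(m : Measure X)) (∫ x, f x ∂(q.1 m : Measure X))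
  rw [dist_comm (∫ x, f x ∂(p.1 m : Measure X)) (∫ x, f (γ • x) ∂(m : Measure X))] at this
  linarith

/-- If a distal minimal system is injective, then `E(M(X), Γ)` is a group, being isomorphic to the
group `E(X, Γ)`. -/
theorem IsInjectiveSystem.isEquicontinuous [MulAction.IsMinimal Γ X] (hd : IsDistal Γ X)
    (h : IsInjectiveSystem Γ X) : IsEquicontinuous Γ X := by
  obtain ⟨e, -⟩ := h
  refine isEquicontinuous_of_invertible hd fun q => ?_
  obtain ⟨r, hr, hr'⟩ := hd.exists_mul_eq_one (e q)
  refine ⟨e.symm r, e.injective ?_, e.injective ?_⟩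
  · rw [map_mul, e.apply_symm_apply, hr, map_one]
  · rw [map_mul, e.apply_symm_apply, hr', map_one]

/-! ### The enveloping operator semigroup -/

/-- The functional `f ↦ ∫ f dμ`. -/
noncomputable def integralFunctional (μ : ProbabilityMeasure X) : FunctionDual X :=
  (LinearMap.mkContinuous
    { toFun := fun f : C(X, ℂ) => ∫ x, f x ∂(μ : Measure X)
      map_add' := fun f g => integral_add (integrable_of_continuous f.continuous _)
        (integrable_of_continuous g.continuous _)
      map_smul' := fun c f => integral_const_mul c _ } 1 fun f => by
    refine (norm_integral_le_of_norm_le_const (C := ‖f‖)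
      (Eventually.of_forall fun x => f.norm_coe_le_norm x)).trans (by simp) : C(X, ℂ) →L[ℂ] ℂ)

theorem integralFunctional_eval (μ : ProbabilityMeasure X) (f : C(X, ℂ)) :
    (integralFunctional μ).eval f = ∫ x, f x ∂(μ : Measure X) :=
  rfl

theorem integralFunctional_smul (γ : Γ) (μ : ProbabilityMeasure X) :
    integralFunctional (γ • μ) = γ • integralFunctional μ :=
  FunctionDual.ext fun f => integral_smul_probabilityMeasure f.continuous γ μ

theorem integralFunctional_diracProba (x : X) :
    integralFunctional (diracProba x) = diracFunctional x :=
  FunctionDual.ext fun f => integral_dirac f x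

theorem isClosedEmbedding_integralFunctional :
    IsClosedEmbedding (integralFunctional : ProbabilityMeasure X → FunctionDual X) := by
  refine Continuous.isClosedEmbedding (FunctionDual.continuous_of_eval fun f => ?_) ?_
  · have hf : ∀ μ : ProbabilityMeasure X, (integralFunctional μ).eval f =
        ((∫ x, (f x).re ∂(μ : Measure X) : ℝ) : ℂ)
          + ((∫ x, (f x).im ∂(μ : Measure X) : ℝ) : ℂ) * Complex.I := fun μ =>
      (integral_re_add_im (𝕜 := ℂ) (integrable_of_continuous f.continuous _)).symm
    simp only [hf]
    exact (Complex.continuous_ofReal.comp (continuous_integral_probabilityMeasure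
      (Complex.continuous_re.comp f.continuous))).add
      ((Complex.continuous_ofReal.comp (continuous_integral_probabilityMeasure
      (Complex.continuous_im.comp f.continuous))).mul continuous_const)
  · intro μ ν h
    refine probabilityMeasure_ext fun f => Complex.ofReal_injective ?_
    have h1 := congrArg (fun ℓ : FunctionDual X =>
      ℓ.eval ⟨fun x => (f x : ℂ), Complex.continuous_ofReal.comp f.continuous⟩) h
    simp only [integralFunctional_eval, ContinuousMap.coe_mk] at h1
    rwa [integral_complex_ofReal, integral_complex_ofReal] at h1

/-- The canonical map `𝓔(X, Γ) → E(X, Γ)` factors through the restriction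
`𝓔(X, Γ) → E(M(X), Γ)` to probability measures. If it is an isomorphism, then `𝓔(X, Γ)` is compact,
so that this restriction is onto, and the natural map `E(M(X), Γ) → E(X, Γ)` is injective. -/
theorem isInjectiveSystem_of_isIsomorphism_operatorNaturalMap
    (h : IsIsomorphism (operatorNaturalMap Γ X)) : IsInjectiveSystem Γ X := by
  obtain ⟨e, he⟩ := h
  have : CompactSpace (envelopingSemigroup Γ (FunctionDual X)) :=
    e.toHomeomorph.symm.compactSpace
  let R := restrict (Γ := Γ) (integralFunctional (X := X)) isClosedEmbedding_integralFunctional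
    integralFunctional_smul
  have hfac : ∀ p : envelopingSemigroup Γ (FunctionDual X),
      naturalMap Γ X (R p) = operatorNaturalMap Γ X p := by
    intro p
    refine Subtype.ext (funext fun x => isClosedEmbedding_diracFunctional.injective ?_)
    have h1 := restrict_spec (diracFunctional : X → FunctionDual X)
      isClosedEmbedding_diracFunctional diracFunctional_smul p x
    have h2 := restrict_spec (fun x : X => diracProba x) isClosedEmbedding_dirac dirac_smul (R p) x
    have h3 := restrict_spec (integralFunctional (X := X)) isClosedEmbedding_integralFunctional
      integralFunctional_smul p (diracProba x)
    rw [integralFunctional_diracProba] at h3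
    refine Eq.trans ?_ h1.symm
    rw [← integralFunctional_diracProba]
    exact (congrArg integralFunctional h2).trans h3
  refine isInjectiveSystem_of_injective fun p q hpq => ?_
  have hR : Function.Surjective R := restrict_surjective _ _ _
  obtain ⟨p, rfl⟩ := hR p
  obtain ⟨q, rfl⟩ := hR q
  have h1 : operatorNaturalMap Γ X p = operatorNaturalMap Γ X q :=
    (hfac p).symm.trans (hpq.trans (hfac q))
  exact congrArg R (e.injective ((he p).trans (h1.trans (he q).symm)))

end Measures

end TopDyn

theorem mainTheorem1 {Γ X : Type*} [Group Γ] [TopologicalSpace Γ] [IsTopologicalGroup Γ]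
    [MetricSpace X] [CompactSpace X] [MeasurableSpace X] [BorelSpace X]
    [MulAction Γ X] [ContinuousSMul Γ X]
    (hmin : MulAction.IsMinimal Γ X) (hdistal : TopDyn.IsDistal Γ X) :
    (TopDyn.IsInjectiveSystem Γ X ↔ TopDyn.IsEquicontinuous Γ X) ∧
    (¬ TopDyn.IsEquicontinuous Γ X →
      ¬ TopDyn.IsInjectiveSystem Γ X ∧
      ¬ TopDyn.IsIsomorphism (TopDyn.operatorNaturalMap Γ X)) :=
  ⟨⟨fun h => h.isEquicontinuous hdistal,
    fun h => TopDyn.isInjectiveSystem_of_injective h.injective_naturalMap⟩,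
   fun hne => ⟨fun h => hne (h.isEquicontinuous hdistal), fun h => hne
    ((TopDyn.isInjectiveSystem_of_isIsomorphism_operatorNaturalMap h).isEquicontinuous hdistal)⟩⟩
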